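/- Let $\mathcal H$ be a finite-dimensional Hilbert space with a fixed orthonormal basis $\{|c\rangle\}$, let $\rho$ be a state on $\mathcal H$ (a positive semidefinite operator of trace one), and let all logarithms be to base $2$. A state is called incoherent if it is diagonal in the fixed basis; $\mathcal C$ denotes the set of incoherent states on $\mathcal H$, and $\mathcal C_n$ the set of states on $\mathcal H^{\otimes n}$ that are diagonal in the product basis. Let $D(\rho\|\sigma)=\operatorname{tr}[\rho(\log\rho-\log\sigma)]$ if $\operatorname{supp}\rho\subseteq\operatorname{supp}\sigma$ and $D(\rho\|\sigma)=\infty$ otherwise, and let $D_{\mathcal C}(\rho):=\inf_{\sigma\in\mathcal C}D(\rho\|\sigma)$ be the relative entropy of coherence. For sets $\mathcal T_n$ of states on $\mathcal H^{\otimes n}$ ($n\ge1$) and $\varepsilon\in(0,1)$ put $$\zeta^n_{\mathcal T}(\varepsilon):=-\frac1n\log\inf_{\substack{0\le M_n\le1\\ \operatorname{tr}[M_n\rho^{\otimes n}]\ge1-\varepsilon}}\ \sup_{\sigma_n\in\mathcal T_n}\operatorname{tr}[M_n\sigma_n],\qquad \zeta_{\mathcal T}(\varepsilon):=\lim_{n\to\infty}\zeta^n_{\mathcal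 T}(\varepsilon),\qquad \zeta_{\mathcal T}(0):=\lim_{\varepsilon\to0^+}\zeta_{\mathcal T}(\varepsilon).$$ **Proposition.** 1. For testing $\rho^{\otimes n}$ against all incoherent states, $\mathcal T_n=\mathcal C_n$, the limits defining $\zeta_{\mathcal C}(\varepsilon)$ (for every $\varepsilon\in(0,1)$) and $\zeta_{\mathcal C}(0)$ exist, and $\zeta_{\mathcal C}(0)=D_{\mathcal C}(\rho)$. 2. For testing $\rho^{\otimes n}$ against iid mixtures of incoherent states, $\mathcal T_n=\bar{\mathcal C}_n:=\{\int\sigma^{\otimes n}\,\mathrm d\mu(\sigma) : \mu \text{ a Borel probability measure on } \mathcal C\}$, the corresponding limits exist as well, and $\bar\zeta_{\bar{\mathcal C}}(0)=D_{\mathcal C}(\rho)$. 3. $D_{\mathcal C}(\rho)=D(\rho\|\rho_{\mathrm{diag}})$, where $\rho_{\mathrm{diag}}$ is obtained from $\rho$ by deleting all off-diagonal entries in the fixed basis. -/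

import Mathlib

open MeasureTheory Filter Topology
open scoped ENNReal ComplexOrder

noncomputable section

namespace Coherence

/-- Density matrices: positive semidefinite matrices of trace one, written in the fixed
orthonormal basis, which is indexed by `ι`. -/
def states (ι : Type*) [Fintype ι] : Set (Matrix ι ι ℂ) :=
  {ρ | ρ.PosSemidef ∧ ρ.trace = 1}

/-- Incoherent states: the states that are diagonal in the fixed basis. -/
def incoherent (ι : Type*) [Fintype ι] : Set (Matrix ι ι ℂ) :=
  {σ | σ ∈ states ι ∧ σ.IsDiag}

/-- The state obtained by deleting all off-diagonal entries. -/
def diagPart {ι : Type*} [DecidableEq ι] (ρ : Matrix ι ι ℂ) : Matrix ι ι ℂ :=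
  Matrix.diagonal fun i => ρ i i

/-- The `n`-fold tensor power, written in the product basis, which is indexed by `Fin n → ι`. -/
def tensorPow {ι : Type*} (n : ℕ) (ρ : Matrix ι ι ℂ) : Matrix (Fin n → ι) (Fin n → ι) ℂ :=
  Matrix.of fun x y => ∏ i, ρ (x i) (y i)

/-- The support: the orthogonal complement of the kernel. -/
def supp {ι : Type*} [Fintype ι] [DecidableEq ι] (A : Matrix ι ι ℂ) :
    Submodule ℂ (EuclideanSpace ℂ ι) :=
  (LinearMap.ker (Matrix.toEuclideanLin A))ᗮ

/-- Base-two logarithm of a Hermitian matrix by functional calculus. As `Real.logb 2 0 = 0`, it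
vanishes on the kernel of a positive semidefinite matrix, which is the usual convention. -/
def matrixLog {ι : Type*} [Fintype ι] [DecidableEq ι] (A : Matrix ι ι ℂ) : Matrix ι ι ℂ :=
  cfc (Real.logb 2) A

open scoped Classical in
/-- Quantum relative entropy `D(ρ‖σ)` (base two), equal to `⊤` unless `supp ρ ⊆ supp σ`. -/
def relEntropy {ι : Type*} [Fintype ι] [DecidableEq ι] (ρ σ : Matrix ι ι ℂ) : EReal :=
  if supp ρ ≤ supp σ then (((ρ * (matrixLog ρ - matrixLog σ)).trace.re : ℝ) : EReal) else ⊤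

/-- Relative entropy of coherence. -/
def relEntropyCoherence {ι : Type*} [Fintype ι] [DecidableEq ι] (ρ : Matrix ι ι ℂ) : EReal :=
  ⨅ σ ∈ incoherent ι, relEntropy ρ σ

/-- Mixtures `∫ σ^{⊗n} dμ(σ)` over Borel probability measures `μ` on the set of incoherent
states (as arrays of entries, with the product Borel structure); the integral is taken entry by
entry. -/
def iidMixtures (ι : Type*) [Fintype ι] (n : ℕ) : Set (Matrix (Fin n → ι) (Fin n → ι) ℂ) :=
  {τ | ∃ μ : Measure (ι → ι → ℂ), IsProbabilityMeasure μ ∧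
    (∀ᵐ σ ∂μ, Matrix.of σ ∈ incoherent ι) ∧
    τ = Matrix.of fun x y => ∫ σ, tensorPow n (Matrix.of σ) x y ∂μ}

/-- Two-outcome tests `0 ≤ M ≤ 1` that accept `ρ` with probability at least `1 - ε`. -/
def tests {κ : Type*} [Fintype κ] [DecidableEq κ] (ρ : Matrix κ κ ℂ) (ε : ℝ) :
    Set (Matrix κ κ ℂ) :=
  {M | M.PosSemidef ∧ (1 - M).PosSemidef ∧ 1 - ε ≤ (M * ρ).trace.re}

/-- The optimal worst-case type 2 error for testing `ρ` against the set `T`, when the type 1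
error is at most `ε`. -/
def typeTwoError {κ : Type*} [Fintype κ] [DecidableEq κ] (ρ : Matrix κ κ ℂ)
    (T : Set (Matrix κ κ ℂ)) (ε : ℝ) : ℝ≥0∞ :=
  ⨅ M ∈ tests ρ ε, ⨆ σ ∈ T, ENNReal.ofReal (M * σ).trace.re

/-- `ζⁿ(ε) = -(1/n) log₂ (optimal type 2 error)`, for testing `ρ^{⊗n}` against `T n`. -/
def exponentAt {ι : Type*} [Fintype ι] [DecidableEq ι] (ρ : Matrix ι ι ℂ)
    (T : ∀ n : ℕ, Set (Matrix (Fin n → ι) (Fin n → ι) ℂ)) (n : ℕ) (ε : ℝ) : EReal :=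
  -(ENNReal.log (typeTwoError (tensorPow n ρ) (T n) ε) / ((Real.log 2 : ℝ) : EReal)) / (n : EReal)

/-- `ζ(0) = z`: the limit `ζ(ε) = lim_n ζⁿ(ε)` exists (in the extended reals) for every
`ε ∈ (0,1)`, and `ζ(ε) → z` as `ε → 0`. -/
def HasSteinExponent {ι : Type*} [Fintype ι] [DecidableEq ι] (ρ : Matrix ι ι ℂ)
    (T : ∀ n : ℕ, Set (Matrix (Fin n → ι) (Fin n → ι) ℂ)) (z : EReal) : Prop :=
  ∃ ζ : ℝ → EReal,
    (∀ ε ∈ Set.Ioo (0 : ℝ) 1, Tendsto (fun n : ℕ => exponentAt ρ T n ε) atTop (𝓝 (ζ ε))) ∧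
    Tendsto ζ (𝓝[>] 0) (𝓝 z)

end Coherence

end

namespace Coherence

open Matrix

/-! ### Trace inequalities for positive matrices and pinching by a coordinate projection. -/

section TracesOfProducts

variable {κ : Type*} [Fintype κ]

/-! Both families of alternatives contain the single state `tensorPow n (diagPart ρ)` and consist of
incoherent states. It therefore suffices to bound the exponent from below against all incoherent
states and from above against that single state. Write S(ρ) for the entropy of the eigenvalues, S(d)
for that of the diagonal entries, and D = S(d) - S(ρ) = D(ρ‖ρ_diag).

Achievability (`exists_test_with_small_diagonal`): let P project onto the typical eigenvectors of
ρ^{⊗n} and Q onto the basis strings typical for d. Since P ≤ 2^{n(S(ρ)+δ)} ρ^{⊗n}, the diagonal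
entries of QPQ are at most 2^{-n(D-2δ)}, and an incoherent state only averages diagonal entries.
This makes the bound uniform over all incoherent states.

Strong converse (`le_trace_mul_diagPart_of_test`): for any test M, the acceptance probability is
essentially bounded by tr(QMQ) times the largest typical eigenvalue, while the type 2 error against
ρ_diag^{⊗n} is at least tr(QMQ) times the smallest typical diagonal entry. The ratio is
2^{-n(D+2δ)}.

P and Q need not commute; `trace_mul_le_pinching` makes the passage to the compression by Q cheap,
and `tendsto_sum_compl_typicalSet` makes the discarded weight vanish. Finally, tr(ρ log σ) with σ
diagonal sees only the diagonal of ρ, so minimising over σ is the classical Gibbs inequality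
(`relEntropyCoherence_eq`). -/

open scoped MatrixOrder Matrix.Norms.L2Operator in
theorem trace_mul_re_nonneg {A B : Matrix κ κ ℂ} (hA : A.PosSemidef)
    (hB : B.PosSemidef) : 0 ≤ (A * B).trace.re := by
  classical
  obtain ⟨C, rfl⟩ := CStarAlgebra.nonneg_iff_eq_star_mul_self.mp (Matrix.nonneg_iff_posSemidef.mpr hB)
  have h : (A * (star C * C)).trace = (C * A * Cᴴ).trace := by
    rw [star_eq_conjTranspose, ← mul_assoc, Matrix.trace_mul_comm, ← mul_assoc]
  rw [h]
  exact (Complex.le_def.mp (hA.mul_mul_conjTranspose_same C).trace_nonneg).1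

theorem trace_mul_re_le_of_sub_posSemidef {A A' B : Matrix κ κ ℂ} (hA : (A' - A).PosSemidef)
    (hB : B.PosSemidef) : (A * B).trace.re ≤ (A' * B).trace.re := by
  have h := trace_mul_re_nonneg hA hB
  rw [Matrix.sub_mul, trace_sub, Complex.sub_re] at h
  linarith

variable [DecidableEq κ]

/-- The diagonal projection onto the coordinates in `S`. -/
def coordProj (S : Finset κ) : Matrix κ κ ℂ :=
  Matrix.diagonal fun x => if x ∈ S then 1 else 0

omit [Fintype κ] in
theorem coordProj_isHermitian (S : Finset κ) : (coordProj S).IsHermitian := by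
  refine Matrix.isHermitian_diagonal_of_self_adjoint _ ?_
  funext x
  simp only [Pi.star_apply]
  split_ifs <;> simp

theorem coordProj_mul_self (S : Finset κ) : coordProj S * coordProj S = coordProj S := by
  simp [coordProj, Matrix.diagonal_mul_diagonal]

theorem coordProj_compl (S : Finset κ) : coordProj Sᶜ = 1 - coordProj S := by
  rw [← Matrix.diagonal_one, coordProj, coordProj, Matrix.diagonal_sub]
  congr 1
  funext x
  by_cases h : x ∈ S <;> simp [h]

theorem coordProj_conj_apply_self (S : Finset κ) (A : Matrix κ κ ℂ) (x : κ) :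
    (coordProj S * A * coordProj S) x x = if x ∈ S then A x x else 0 := by
  by_cases h : x ∈ S <;>
  simp [coordProj, Matrix.mul_diagonal, Matrix.diagonal_mul, h]

theorem coordProj_conj_posSemidef (S : Finset κ) {A : Matrix κ κ ℂ} (hA : A.PosSemidef) :
    (coordProj S * A * coordProj S).PosSemidef := by
  simpa [(coordProj_isHermitian S).eq] using hA.mul_mul_conjTranspose_same (coordProj S)

theorem coordProj_posSemidef (S : Finset κ) : (coordProj S).PosSemidef := by
  simpa [coordProj_mul_self] using coordProj_conj_posSemidef S Matrix.PosSemidef.one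

theorem one_sub_coordProj_conj_posSemidef (S : Finset κ) {A : Matrix κ κ ℂ}
    (hA : (1 - A).PosSemidef) : (1 - coordProj S * A * coordProj S).PosSemidef := by
  have h : 1 - coordProj S * A * coordProj S
      = coordProj S * (1 - A) * coordProj S + coordProj Sᶜ := by
    rw [coordProj_compl, Matrix.mul_sub, Matrix.sub_mul, Matrix.mul_one, coordProj_mul_self]
    abel
  rw [h]
  exact (coordProj_conj_posSemidef S hA).add (coordProj_posSemidef _)

theorem trace_coordProj_mul_re (S : Finset κ) (R : Matrix κ κ ℂ) :
    (coordProj S * R).trace.re = ∑ x ∈ S, (R x x).re := by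
  simp [coordProj, Matrix.trace, Matrix.diagonal_mul, Complex.re_sum]

theorem trace_coordProj_conj_re (S : Finset κ) (A : Matrix κ κ ℂ) :
    (coordProj S * A * coordProj S).trace.re = ∑ x ∈ S, (A x x).re := by
  rw [Matrix.trace_mul_comm, ← mul_assoc, coordProj_mul_self, trace_coordProj_mul_re]

/-- A two-block pinching inequality, in trace form. -/
theorem trace_mul_le_pinching (S : Finset κ) {A R : Matrix κ κ ℂ} (hA : A.PosSemidef)
    (hA' : (1 - A).PosSemidef) (hR : R.PosSemidef) {t : ℝ} (ht : 0 < t) :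
    (A * R).trace.re ≤ (1 + t) * (coordProj S * A * coordProj S * R).trace.re
      + (1 + t⁻¹) * ∑ x ∈ Sᶜ, (R x x).re := by
  set Q := coordProj S with hQ
  set Q' := coordProj Sᶜ with hQ'
  have hQh : Qᴴ = Q := (coordProj_isHermitian S).eq
  have hQh' : Q'ᴴ = Q' := (coordProj_isHermitian Sᶜ).eq
  have hsum : Q + Q' = 1 := by rw [hQ', coordProj_compl, hQ]; abel
  have hoff : (Q' * A * Q' * R).trace.re ≤ ∑ x ∈ Sᶜ, (R x x).re := by
    rw [← trace_coordProj_mul_re]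
    refine trace_mul_re_le_of_sub_posSemidef ?_ hR
    have := coordProj_conj_posSemidef Sᶜ hA'
    rwa [Matrix.mul_sub, Matrix.sub_mul, Matrix.mul_one, coordProj_mul_self] at this
  -- The left side is positive and its cross terms are those of -tA. Dividing by t gives A ≤ (1+t)
  -- QAQ + (1+t⁻¹) Q'AQ'.
  have hB : ((t : ℂ) • Q - Q') * A * ((t : ℂ) • Q - Q')
      = (t : ℂ) • (((1 + t : ℝ) : ℂ) • (Q * A * Q) + ((1 + t⁻¹ : ℝ) : ℂ) • (Q' * A * Q') - A) := by
    have hAexp : A = Q * A * Q + Q * A * Q' + Q' * A * Q + Q' * A * Q' := by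
      calc A = (Q + Q') * A * (Q + Q') := by rw [hsum]; simp
        _ = _ := by noncomm_ring
    have ht0 : (t : ℂ) ≠ 0 := by exact_mod_cast ht.ne'
    conv_rhs => rw [hAexp]
    simp only [Matrix.sub_mul, Matrix.mul_sub, Matrix.smul_mul, Matrix.mul_smul, smul_sub, smul_add,
      Complex.ofReal_add, Complex.ofReal_inv, Complex.ofReal_one, add_smul, one_smul, smul_smul]
    have e1 : Q * (Q * A * Q) * Q = Q * A * Q := by
      have : Q * Q = Q := coordProj_mul_self S
      calc Q * (Q * A * Q) * Q = (Q * Q) * A * (Q * Q) := by noncomm_ring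
        _ = _ := by rw [this]
    have q1 : Q * Q = Q := coordProj_mul_self S
    have q2 : Q' * Q' = Q' := coordProj_mul_self Sᶜ
    have q3 : Q * Q' = 0 := by
      have := congrArg (Q * ·) hsum
      simpa [Matrix.mul_add, q1] using this
    have q4 : Q' * Q = 0 := by
      have := congrArg (Q' * ·) hsum
      simpa [Matrix.mul_add, q2] using this
    have r1 : ∀ X, Q * (Q * X) = Q * X := fun X => by rw [← mul_assoc, q1]
    have r2 : ∀ X, Q' * (Q' * X) = Q' * X := fun X => by rw [← mul_assoc, q2]
    have r3 : ∀ X, Q * (Q' * X) = 0 := fun X => by rw [← mul_assoc, q3, Matrix.zero_mul]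
    have r4 : ∀ X, Q' * (Q * X) = 0 := fun X => by rw [← mul_assoc, q4, Matrix.zero_mul]
    simp only [Matrix.mul_add, Matrix.add_mul, mul_assoc, q1, q2, q3, q4, r1, r2, r3, r4,
      Matrix.mul_zero, add_zero, zero_add, mul_inv_cancel₀ ht0, one_smul]
    abel
  have hBh : (((t : ℂ) • Q - Q')ᴴ) = (t : ℂ) • Q - Q' := by
    rw [conjTranspose_sub, conjTranspose_smul, hQh, hQh']
    simp
  have hpos := hA.mul_mul_conjTranspose_same ((t : ℂ) • Q - Q')
  rw [hBh, hB] at hpos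
  have h := trace_mul_re_nonneg hpos hR
  simp only [Matrix.smul_mul, Matrix.sub_mul, Matrix.add_mul, trace_smul, trace_sub, trace_add,
    smul_eq_mul, Complex.re_ofReal_mul, Complex.sub_re, Complex.add_re] at h
  have h2 := nonneg_of_mul_nonneg_right h ht
  have h3 : (1 + t⁻¹) * (Q' * A * Q' * R).trace.re ≤ (1 + t⁻¹) * ∑ x ∈ Sᶜ, (R x x).re :=
    mul_le_mul_of_nonneg_left hoff (by positivity)
  linarith

end TracesOfProducts

/-! ### One-shot bounds: a good test, and a limit on every test. -/

section OneShot

variable {κ : Type*} [Fintype κ] [DecidableEq κ] {V : Matrix κ κ ℂ} {w : κ → ℝ}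

/-- The matrix with eigenvector matrix `V` and eigenvalues `w`. -/
def spectralMatrix (V : Matrix κ κ ℂ) (w : κ → ℝ) : Matrix κ κ ℂ :=
  V * Matrix.diagonal (fun x => (w x : ℂ)) * Vᴴ

theorem spectralMatrix_posSemidef (V : Matrix κ κ ℂ) {w : κ → ℝ} (hw : ∀ x, 0 ≤ w x) :
    (spectralMatrix V w).PosSemidef := by
  refine PosSemidef.mul_mul_conjTranspose_same (.diagonal fun x => ?_) V
  simpa using hw x

theorem spectralMatrix_sub (V : Matrix κ κ ℂ) (v w : κ → ℝ) :
    spectralMatrix V v - spectralMatrix V w = spectralMatrix V (v - w) := by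
  simp [spectralMatrix, ← Matrix.mul_sub, ← Matrix.sub_mul, Matrix.diagonal_sub]

theorem smul_spectralMatrix (V : Matrix κ κ ℂ) (c : ℝ) (w : κ → ℝ) :
    (c : ℂ) • spectralMatrix V w = spectralMatrix V (c • w) := by
  rw [spectralMatrix, spectralMatrix, ← Matrix.smul_mul, ← Matrix.mul_smul]
  congr 2
  ext i j
  by_cases h : i = j <;> simp [h]

theorem spectralMatrix_one (hV : V * Vᴴ = 1) : spectralMatrix V 1 = 1 := by
  simp [spectralMatrix, hV]

theorem spectralMatrix_mul (hV : Vᴴ * V = 1) (v w : κ → ℝ) :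
    spectralMatrix V v * spectralMatrix V w = spectralMatrix V (v * w) := by
  calc spectralMatrix V v * spectralMatrix V w
      = V * diagonal (fun x => (v x : ℂ)) * (Vᴴ * V) * diagonal (fun x => (w x : ℂ)) * Vᴴ := by
        simp only [spectralMatrix, mul_assoc]
    _ = _ := by
        rw [hV, Matrix.mul_one, mul_assoc V, diagonal_mul_diagonal]
        simp [spectralMatrix]

theorem trace_spectralMatrix (hV : Vᴴ * V = 1) (w : κ → ℝ) :
    (spectralMatrix V w).trace.re = ∑ x, w x := by
  rw [spectralMatrix, trace_mul_comm, ← mul_assoc, hV, Matrix.one_mul, trace_diagonal]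
  simp

/-- If the eigenvalues on `T` are at least `a`, and the diagonal entries on `S` at most `e`, and
both sets carry almost full weight, then some test accepts with high probability and has small
diagonal entries. -/
theorem exists_test_with_small_diagonal (hV : Vᴴ * V = 1) (hw : ∀ x, 0 ≤ w x)
    (hw1 : ∑ x, w x = 1)
    {S T : Finset κ} {a e η t : ℝ} (ha : 0 < a) (he : 0 ≤ e) (ht : 0 < t)
    (hT : ∀ x ∈ T, a ≤ w x) (hS : ∀ x ∈ S, (spectralMatrix V w x x).re ≤ e)
    (hT' : ∑ x ∈ Tᶜ, w x ≤ η) (hS' : ∑ x ∈ Sᶜ, (spectralMatrix V w x x).re ≤ η) :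
    ∃ M : Matrix κ κ ℂ, M.PosSemidef ∧ (1 - M).PosSemidef ∧
      1 - η ≤ (1 + t) * (M * spectralMatrix V w).trace.re + (1 + t⁻¹) * η ∧
      ∀ x, (M x x).re ≤ e / a := by
  have hV' : V * Vᴴ = 1 := mul_eq_one_comm.mp hV
  set R := spectralMatrix V w with hR
  have hRp : R.PosSemidef := spectralMatrix_posSemidef V hw
  -- `spectralMatrix V χ` is the spectral projection for `T`; the test is its compression to the
  -- coordinates in `S`.
  let χ : κ → ℝ := fun x => if x ∈ T then 1 else 0
  have hχ : ∀ x, 0 ≤ χ x := fun x => by dsimp only [χ]; split_ifs <;> norm_num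
  have hPp : (spectralMatrix V χ).PosSemidef := spectralMatrix_posSemidef V hχ
  have hPp' : (1 - spectralMatrix V χ).PosSemidef := by
    rw [← spectralMatrix_one hV', spectralMatrix_sub]
    refine spectralMatrix_posSemidef V fun x => ?_
    simp only [χ, Pi.sub_apply, Pi.one_apply]
    split_ifs <;> norm_num
  refine ⟨coordProj S * spectralMatrix V χ * coordProj S, coordProj_conj_posSemidef S hPp,
    one_sub_coordProj_conj_posSemidef S hPp', ?_, fun x => ?_⟩
  · have h := trace_mul_le_pinching S hPp hPp' hRp ht
    have h2 : (spectralMatrix V χ * R).trace.re = 1 - ∑ x ∈ Tᶜ, w x := by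
      have e : ∑ x, (χ * w) x = ∑ x ∈ T, w x := by simp [χ]
      rw [hR, spectralMatrix_mul hV, trace_spectralMatrix hV, e, ← hw1,
        ← Finset.sum_add_sum_compl T w, add_sub_cancel_right]
    have h3 : (1 + t⁻¹) * ∑ x ∈ Sᶜ, (R x x).re ≤ (1 + t⁻¹) * η :=
      mul_le_mul_of_nonneg_left hS' (by positivity)
    linarith
  · rw [coordProj_conj_apply_self]
    split_ifs with hx
    · have h : ((((a⁻¹ : ℝ) : ℂ) • R) - spectralMatrix V χ).PosSemidef := by
        rw [hR, smul_spectralMatrix, spectralMatrix_sub]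
        refine spectralMatrix_posSemidef V fun y => ?_
        simp only [χ, Pi.sub_apply, Pi.smul_apply, smul_eq_mul]
        split_ifs with hy
        · have : 1 ≤ a⁻¹ * w y := by
            rw [← div_eq_inv_mul, one_le_div ha]
            exact hT y hy
          linarith
        · have := mul_nonneg (inv_nonneg.mpr ha.le) (hw y)
          linarith
      have h1 := (Complex.le_def.mp (h.diag_nonneg (i := x))).1
      simp only [Matrix.sub_apply, Matrix.smul_apply, smul_eq_mul, Complex.sub_re,
        Complex.re_ofReal_mul, Complex.zero_re] at h1
      have h2 : a⁻¹ * (R x x).re ≤ a⁻¹ * e :=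
        mul_le_mul_of_nonneg_left (hS x hx) (inv_nonneg.mpr ha.le)
      rw [div_eq_inv_mul]
      linarith
    · simpa using div_nonneg he ha.le

/-- One-shot strong converse: if the eigenvalues on `T` are at most `b`, and the diagonal entries
on `S` at least `c`, and both sets carry almost full weight, then no test that accepts with
decent probability can have a small type 2 error against the diagonal part. -/
theorem le_trace_mul_diagPart_of_test (hV : Vᴴ * V = 1) (hw : ∀ x, 0 ≤ w x)
    {S T : Finset κ} {b c η p : ℝ} (hb : 0 < b) (hc : 0 ≤ c)
    (hT : ∀ x ∈ T, w x ≤ b) (hS : ∀ x ∈ S, c ≤ (spectralMatrix V w x x).re)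
    (hT' : ∑ x ∈ Tᶜ, w x ≤ η) (hS' : ∑ x ∈ Sᶜ, (spectralMatrix V w x x).re ≤ η)
    {M : Matrix κ κ ℂ} (hM : M.PosSemidef) (hM' : (1 - M).PosSemidef)
    (hp : p ≤ (M * spectralMatrix V w).trace.re) :
    c / b * ((p - 3 * η) / 2) ≤ (M * diagPart (spectralMatrix V w)).trace.re := by
  have hV' : V * Vᴴ = 1 := mul_eq_one_comm.mp hV
  set R := spectralMatrix V w with hR
  have hRp : R.PosSemidef := spectralMatrix_posSemidef V hw
  have hRd : ∀ x, 0 ≤ (R x x).re := fun x => (Complex.le_def.mp (hRp.diag_nonneg (i := x))).1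
  have hRi : ∀ x, (R x x).im = 0 := fun x =>
    (Complex.le_def.mp (hRp.diag_nonneg (i := x))).2.symm
  have hMd : ∀ x, 0 ≤ (M x x).re := fun x => (Complex.le_def.mp (hM.diag_nonneg (i := x))).1
  -- Truncating the spectrum to `T` gives an operator bounded by `b`, at the cost of trace `η`.
  let u : κ → ℝ := fun x => if x ∈ T then w x else 0
  have hu : ∀ x, 0 ≤ u x := fun x => by dsimp only [u]; split_ifs; exacts [hw x, le_rfl]
  have hup : (spectralMatrix V u).PosSemidef := spectralMatrix_posSemidef V hu
  have hwu : (spectralMatrix V (w - u)).PosSemidef := spectralMatrix_posSemidef V fun x => by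
    simp only [u, Pi.sub_apply]
    split_ifs
    · simp
    · simpa using hw x
  have hdiff : R - spectralMatrix V u = spectralMatrix V (w - u) := by rw [hR, spectralMatrix_sub]
  set QMQ := coordProj S * M * coordProj S with hQMQ
  have hQp : QMQ.PosSemidef := coordProj_conj_posSemidef S hM
  -- discarding the atypical eigenvalues
  have h1 : p - η ≤ (M * spectralMatrix V u).trace.re := by
    have e1 : (M * R).trace.re
        = (M * spectralMatrix V u).trace.re + (M * spectralMatrix V (w - u)).trace.re := by
      rw [← hdiff, Matrix.mul_sub, trace_sub, Complex.sub_re]; ring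
    have e2 := trace_mul_re_le_of_sub_posSemidef hM' hwu
    rw [Matrix.one_mul, trace_spectralMatrix hV] at e2
    have e3 : ∑ x, (w - u) x = ∑ x ∈ Tᶜ, w x := by
      rw [← Finset.sum_add_sum_compl T]
      have z : ∑ x ∈ T, (w - u) x = 0 :=
        Finset.sum_eq_zero fun x hx => by simp [u, hx]
      rw [z, zero_add]
      refine Finset.sum_congr rfl fun x hx => ?_
      simp [u, Finset.mem_compl.mp hx]
    linarith
  -- discarding the atypical coordinates
  have h2 : (M * spectralMatrix V u).trace.re
      ≤ 2 * (QMQ * spectralMatrix V u).trace.re + 2 * η := by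
    have h := trace_mul_le_pinching S hM hM' hup one_pos
    have e : ∑ x ∈ Sᶜ, (spectralMatrix V u x x).re ≤ ∑ x ∈ Sᶜ, (R x x).re := by
      refine Finset.sum_le_sum fun x _ => ?_
      have := (Complex.le_def.mp (hwu.diag_nonneg (i := x))).1
      rw [← hdiff] at this
      simp only [Matrix.sub_apply, Complex.sub_re, Complex.zero_re] at this
      linarith
    norm_num at h
    linarith
  have h3 : (QMQ * spectralMatrix V u).trace.re ≤ b * QMQ.trace.re := by
    have hb1 : ((b : ℂ) • (1 : Matrix κ κ ℂ) - spectralMatrix V u).PosSemidef := by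
      rw [← spectralMatrix_one hV', smul_spectralMatrix, spectralMatrix_sub]
      refine spectralMatrix_posSemidef V fun x => ?_
      simp only [u, Pi.sub_apply, Pi.smul_apply, Pi.one_apply, smul_eq_mul, mul_one]
      split_ifs with hx
      · linarith [hT x hx]
      · linarith
    have h := trace_mul_re_nonneg hQp hb1
    rw [Matrix.mul_sub, Matrix.mul_smul, Matrix.mul_one, trace_sub, trace_smul, smul_eq_mul,
      Complex.sub_re, Complex.re_ofReal_mul] at h
    linarith
  have h4 : c * QMQ.trace.re ≤ (M * diagPart R).trace.re := by
    rw [hQMQ, trace_coordProj_conj_re, Finset.mul_sum]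
    have e : (M * diagPart R).trace.re = ∑ x, (M x x).re * (R x x).re := by
      simp [diagPart, Matrix.trace, Matrix.mul_diagonal, Complex.re_sum, Complex.mul_re, hRi]
    rw [e]
    calc ∑ x ∈ S, c * (M x x).re ≤ ∑ x ∈ S, (M x x).re * (R x x).re :=
          Finset.sum_le_sum fun x hx => by
            rw [mul_comm]
            exact mul_le_mul_of_nonneg_left (hS x hx) (hMd x)
      _ ≤ ∑ x, (M x x).re * (R x x).re :=
          Finset.sum_le_sum_of_subset_of_nonneg (Finset.subset_univ _)
            fun x _ _ => mul_nonneg (hMd x) (hRd x)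
  have h5 : (p - 3 * η) / 2 ≤ b * QMQ.trace.re := by linarith
  calc c / b * ((p - 3 * η) / 2) ≤ c / b * (b * QMQ.trace.re) :=
        mul_le_mul_of_nonneg_left h5 (div_nonneg hc hb.le)
    _ = c * QMQ.trace.re := by field_simp
    _ ≤ _ := h4

end OneShot

/-! ### Tensor powers respect products, adjoints and spectral decompositions. -/

section TensorPow

variable {ι : Type*}

theorem tensorPow_mul [Fintype ι] (n : ℕ) (A B : Matrix ι ι ℂ) :
    tensorPow n (A * B) = tensorPow n A * tensorPow n B := by
  classical
  ext x y
  simp only [tensorPow, Matrix.of_apply, Matrix.mul_apply, Finset.prod_univ_sum,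
    Fintype.piFinset_univ, Finset.prod_mul_distrib]

theorem tensorPow_conjTranspose (n : ℕ) (A : Matrix ι ι ℂ) :
    tensorPow n Aᴴ = (tensorPow n A)ᴴ := by
  ext x y
  simp [tensorPow, Matrix.conjTranspose_apply]

theorem tensorPow_diagonal [DecidableEq ι] (n : ℕ) (d : ι → ℂ) :
    tensorPow n (Matrix.diagonal d) = Matrix.diagonal fun x => ∏ i, d (x i) := by
  ext x y
  simp only [tensorPow, Matrix.of_apply, Matrix.diagonal_apply]
  split_ifs with h
  · subst h; simp
  · obtain ⟨i, hi⟩ := Function.ne_iff.mp h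
    exact Finset.prod_eq_zero (Finset.mem_univ i) (if_neg hi)

theorem tensorPow_one [DecidableEq ι] (n : ℕ) :
    tensorPow n (1 : Matrix ι ι ℂ) = 1 := by
  rw [← Matrix.diagonal_one, tensorPow_diagonal]
  simp

theorem tensorPow_spectralMatrix [Fintype ι] [DecidableEq ι] (n : ℕ) (V : Matrix ι ι ℂ)
    (w : ι → ℝ) :
    tensorPow n (spectralMatrix V w) = spectralMatrix (tensorPow n V) fun x => ∏ i, w (x i) := by
  simp [spectralMatrix, tensorPow_mul, tensorPow_conjTranspose, tensorPow_diagonal]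

theorem tensorPow_diagPart [DecidableEq ι] (n : ℕ) (A : Matrix ι ι ℂ) :
    tensorPow n (diagPart A) = diagPart (tensorPow n A) := by
  rw [diagPart, tensorPow_diagonal]
  rfl

end TensorPow

/-! ### Typical strings, by Chebyshev's inequality. -/

section Typicality

variable {ι : Type*} [Fintype ι]

theorem sum_prod_eq_one {p : ι → ℝ} (hp1 : ∑ a, p a = 1) (n : ℕ) :
    ∑ x : Fin n → ι, ∏ i, p (x i) = 1 := by
  classical
  have h := Finset.prod_univ_sum (fun _ : Fin n => (Finset.univ : Finset ι)) fun _ a => p a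
  rw [Fintype.piFinset_univ] at h
  rw [← h]
  simp [hp1]

theorem sum_fin_succ (n : ℕ) (F : (Fin (n + 1) → ι) → ℝ) :
    ∑ x, F x = ∑ a, ∑ y : Fin n → ι, F (Fin.cons a y) := by
  rw [← (Fin.consEquiv fun _ => ι).sum_comp, Fintype.sum_prod_type]
  rfl

/-- A sum of centred variables is centred; this kills the cross term in the variance recursion. -/
theorem sum_prod_mul_sum_eq_zero {p g : ι → ℝ} (hp1 : ∑ a, p a = 1) (hg : ∑ a, p a * g a = 0)
    (n : ℕ) : ∑ x : Fin n → ι, (∏ i, p (x i)) * ∑ i, g (x i) = 0 := by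
  induction n with
  | zero => simp
  | succ n ih =>
    rw [sum_fin_succ]
    have h : ∀ a, ∑ y : Fin n → ι, (∏ i, p ((Fin.cons a y : Fin (n + 1) → ι) i)) *
        ∑ i, g ((Fin.cons a y : Fin (n + 1) → ι) i) = p a * g a := fun a => by
      simp only [Fin.prod_univ_succ, Fin.sum_univ_succ, Fin.cons_zero, Fin.cons_succ, mul_add,
        Finset.sum_add_distrib, mul_assoc]
      rw [← Finset.mul_sum, ← Finset.mul_sum, ih, ← Finset.sum_mul, sum_prod_eq_one hp1]
      ring
    simp only [h, hg]

/-- Independent centred variables: the variance of the sum is the sum of the variances. -/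
theorem sum_prod_mul_sum_sq {p g : ι → ℝ} (hp1 : ∑ a, p a = 1) (hg : ∑ a, p a * g a = 0)
    (n : ℕ) :
    ∑ x : Fin n → ι, (∏ i, p (x i)) * (∑ i, g (x i)) ^ 2 = n * ∑ a, p a * g a ^ 2 := by
  induction n with
  | zero => simp
  | succ n ih =>
    rw [sum_fin_succ]
    have h : ∀ a, ∑ y : Fin n → ι, (∏ i, p ((Fin.cons a y : Fin (n + 1) → ι) i)) *
        (∑ i, g ((Fin.cons a y : Fin (n + 1) → ι) i)) ^ 2
        = p a * g a ^ 2 + p a * (n * ∑ a, p a * g a ^ 2) := fun a => by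
      simp only [Fin.prod_univ_succ, Fin.sum_univ_succ, Fin.cons_zero, Fin.cons_succ]
      have e : ∀ y : Fin n → ι, (p a * ∏ i, p (y i)) * (g a + ∑ i, g (y i)) ^ 2
          = p a * g a ^ 2 * ∏ i, p (y i) + 2 * p a * g a * ((∏ i, p (y i)) * ∑ i, g (y i))
            + p a * ((∏ i, p (y i)) * (∑ i, g (y i)) ^ 2) := fun y => by ring
      simp only [e, Finset.sum_add_distrib, ← Finset.mul_sum]
      rw [sum_prod_mul_sum_eq_zero hp1 hg, sum_prod_eq_one hp1, ih]
      ring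
    simp only [h, Finset.sum_add_distrib, ← Finset.sum_mul, hp1]
    push_cast
    ring

/-- The negative Shannon entropy (base two). -/
noncomputable def negEntropy (p : ι → ℝ) : ℝ := ∑ a, p a * Real.logb 2 (p a)

open scoped Classical in
/-- The strings whose probability is `2 ^ (n (h ± δ))`, where `-h` is the entropy. -/
noncomputable def typicalSet (p : ι → ℝ) (n : ℕ) (δ : ℝ) : Finset (Fin n → ι) :=
  {x | (2 : ℝ) ^ (n * (negEntropy p - δ)) ≤ ∏ i, p (x i) ∧
    ∏ i, p (x i) ≤ (2 : ℝ) ^ (n * (negEntropy p + δ))}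

/-- Chebyshev's inequality for the sum of the centred variables log p(xᵢ): on an atypical string of
positive probability it deviates by at least nδ. -/
theorem sum_compl_typicalSet_mul_le {p : ι → ℝ} (hp : ∀ a, 0 ≤ p a) (hp1 : ∑ a, p a = 1) (n : ℕ)
    {δ : ℝ} (hδ : 0 < δ) [DecidableEq ι] :
    (∑ x ∈ (typicalSet p n δ)ᶜ, ∏ i, p (x i)) * (n * δ) ^ 2
      ≤ n * ∑ a, p a * (Real.logb 2 (p a) - negEntropy p) ^ 2 := by
  set g : ι → ℝ := fun a => Real.logb 2 (p a) - negEntropy p with hg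
  have hg0 : ∑ a, p a * g a = 0 := by
    simp only [hg, mul_sub, Finset.sum_sub_distrib, ← Finset.sum_mul, hp1]
    simp [negEntropy]
  rw [← sum_prod_mul_sum_sq hp1 hg0, Finset.sum_mul]
  have hpp : ∀ x : Fin n → ι, 0 ≤ ∏ i, p (x i) := fun x => Finset.prod_nonneg fun i _ => hp _
  refine le_trans (Finset.sum_le_sum fun x hx => ?_)
    (Finset.sum_le_sum_of_subset_of_nonneg (Finset.subset_univ (typicalSet p n δ)ᶜ)
      fun x _ _ => mul_nonneg (hpp x) (sq_nonneg _))
  -- Strings of probability zero carry no weight, so the default value `Real.logb 2 0 = 0` does no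
  -- harm.
  rcases (hpp x).eq_or_lt with h0 | hpos
  · simp [← h0]
  refine mul_le_mul_of_nonneg_left ?_ (hpp x)
  have hne : ∀ i, p (x i) ≠ 0 := fun i => (Finset.prod_ne_zero_iff.mp hpos.ne') i (Finset.mem_univ i)
  have hlog : Real.logb 2 (∏ i, p (x i)) = n * negEntropy p + ∑ i, g (x i) := by
    rw [Real.logb_prod _ _ fun i _ => hne i]
    simp [hg]
  rw [sq_le_sq, abs_of_nonneg (by positivity : 0 ≤ n * δ)]
  by_contra! hlt
  refine Finset.mem_compl.mp hx ?_
  rw [abs_lt] at hlt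
  simp only [typicalSet, Finset.mem_filter, Finset.mem_univ, true_and]
  rw [← Real.le_logb_iff_rpow_le one_lt_two hpos, ← Real.logb_le_iff_le_rpow one_lt_two hpos, hlog]
  constructor <;> linarith

/-- Asymptotic equipartition: the atypical strings have vanishing probability. -/
theorem tendsto_sum_compl_typicalSet {p : ι → ℝ} (hp : ∀ a, 0 ≤ p a) (hp1 : ∑ a, p a = 1)
    {δ : ℝ} (hδ : 0 < δ) [DecidableEq ι] :
    Tendsto (fun n => ∑ x ∈ (typicalSet p n δ)ᶜ, ∏ i, p (x i)) atTop (𝓝 0) := by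
  set C := ∑ a, p a * (Real.logb 2 (p a) - negEntropy p) ^ 2
  have hlim : Tendsto (fun n : ℕ => (C / δ ^ 2) / (n : ℝ)) atTop (𝓝 0) :=
    tendsto_const_div_atTop_nhds_zero_nat _
  refine tendsto_of_tendsto_of_tendsto_of_le_of_le' tendsto_const_nhds hlim
    (.of_forall fun n => Finset.sum_nonneg fun x _ => Finset.prod_nonneg fun i _ => hp _) ?_
  filter_upwards [eventually_gt_atTop 0] with n hn
  have hn' : (0 : ℝ) < n := by exact_mod_cast hn
  have h := sum_compl_typicalSet_mul_le hp hp1 n hδ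
  rw [div_div, le_div_iff₀ (by positivity)]
  have h2 : n * ((∑ x ∈ (typicalSet p n δ)ᶜ, ∏ i, p (x i)) * (δ ^ 2 * n)) ≤ n * C := by
    calc _ = (∑ x ∈ (typicalSet p n δ)ᶜ, ∏ i, p (x i)) * (n * δ) ^ 2 := by ring
      _ ≤ _ := h
  exact le_of_mul_le_mul_left h2 hn'

end Typicality

/-! ### Relative entropy to a diagonal state, and its minimiser. -/

section RelEntropy

variable {ι : Type*} [Fintype ι] [DecidableEq ι]

theorem exists_spectralMatrix_eq {ρ : Matrix ι ι ℂ} (hρ : ρ.PosSemidef) :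
    ∃ (V : Matrix ι ι ℂ) (w : ι → ℝ), Vᴴ * V = 1 ∧ (∀ a, 0 ≤ w a) ∧ ρ = spectralMatrix V w ∧
      ∀ f : ℝ → ℝ, cfc f ρ = spectralMatrix V (f ∘ w) := by
  refine ⟨hρ.1.eigenvectorUnitary, hρ.1.eigenvalues, ?_, hρ.eigenvalues_nonneg, ?_, fun f => ?_⟩
  · exact Unitary.coe_star_mul_self hρ.1.eigenvectorUnitary
  · conv_lhs => rw [hρ.1.spectral_theorem]
    rfl
  · rw [hρ.1.cfc_eq]
    rfl

theorem aeval_diagonal_ofReal (q : Polynomial ℝ) (d : ι → ℝ) :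
    Polynomial.aeval (Matrix.diagonal fun i => (d i : ℂ)) q
      = Matrix.diagonal fun i => ((q.eval (d i) : ℝ) : ℂ) := by
  induction q using Polynomial.induction_on' with
  | add p q hp hq =>
    rw [map_add, hp, hq, Matrix.diagonal_add]
    simp
  | monomial n c =>
    rw [Polynomial.aeval_monomial, Matrix.diagonal_pow, Matrix.algebraMap_eq_diagonal,
      Matrix.diagonal_mul_diagonal]
    simp

/-- On finitely many points `f` agrees with a Lagrange polynomial, and polynomials act entrywise on
diagonal matrices. -/
theorem cfc_diagonal (f : ℝ → ℝ) (d : ι → ℝ) :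
    cfc f (Matrix.diagonal fun i => (d i : ℂ)) = Matrix.diagonal fun i => ((f (d i) : ℝ) : ℂ) := by
  classical
  set A : Matrix ι ι ℂ := Matrix.diagonal fun i => (d i : ℂ) with hA
  have hAs : IsSelfAdjoint A := by
    refine Matrix.isHermitian_diagonal_of_self_adjoint _ ?_
    funext i
    simp
  -- Taking both the spectrum and the entries as nodes avoids proving that they coincide.
  let s : Finset ℝ := (Matrix.finite_real_spectrum (A := A)).toFinset ∪ Finset.univ.image d
  set q := Lagrange.interpolate s id f with hq
  have hqs : ∀ x ∈ s, q.eval x = f x := fun x hx =>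
    Lagrange.eval_interpolate_at_node f Function.injective_id.injOn hx
  rw [cfc_congr (g := q.eval) fun x hx => (hqs x (Finset.mem_union_left _ (by simpa using hx))).symm,
    cfc_polynomial q A hAs, hA, aeval_diagonal_ofReal]
  congr 1
  funext i
  rw [hqs]
  exact Finset.mem_union_right _ (Finset.mem_image_of_mem d (Finset.mem_univ i))

omit [Fintype ι] in
theorem eq_diagonal_re {σ : Matrix ι ι ℂ} (hσ : σ.PosSemidef) (hd : σ.IsDiag) :
    σ = Matrix.diagonal fun i => ((σ i i).re : ℂ) := by
  ext i j
  by_cases h : i = j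
  · subst h
    rw [Matrix.diagonal_apply_eq]
    exact (Complex.ext rfl (Complex.le_def.mp hσ.diag_nonneg).2.symm)
  · rw [Matrix.diagonal_apply_ne _ h, hd h]

omit [Fintype ι] [DecidableEq ι] in
theorem diag_re_nonneg {ρ : Matrix ι ι ℂ} (hρ : ρ.PosSemidef) (i : ι) : 0 ≤ (ρ i i).re :=
  (Complex.le_def.mp (hρ.diag_nonneg (i := i))).1

omit [DecidableEq ι] in
theorem sum_diag_re {ρ : Matrix ι ι ℂ} (hρ : ρ ∈ states ι) : ∑ i, (ρ i i).re = 1 := by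
  have h := congrArg Complex.re hρ.2
  simpa [Matrix.trace] using h

theorem diagPart_mem_incoherent {ρ : Matrix ι ι ℂ} (hρ : ρ ∈ states ι) :
    diagPart ρ ∈ incoherent ι := by
  refine ⟨⟨.diagonal fun i => hρ.1.diag_nonneg, ?_⟩, Matrix.isDiag_diagonal _⟩
  rw [diagPart, Matrix.trace_diagonal]
  exact hρ.2

theorem col_eq_zero_of_diag_eq_zero {ρ : Matrix ι ι ℂ} (hρ : ρ.PosSemidef) {i : ι}
    (h : ρ i i = 0) (j : ι) : ρ j i = 0 := by
  have := (hρ.dotProduct_mulVec_zero_iff (Pi.single i 1)).mp (by simp [h])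
  simpa using congrFun this j

theorem supp_le_supp_iff {A B : Matrix ι ι ℂ} :
    supp A ≤ supp B ↔
      ∀ v : ι → ℂ, B *ᵥ v = 0 → A *ᵥ v = 0 := by
  rw [supp, supp, Submodule.orthogonal_le_orthogonal_iff]
  constructor
  · intro h v hv
    have := @h (WithLp.toLp 2 v) (by
      rw [LinearMap.mem_ker, Matrix.toLpLin_toLp]
      simpa using hv)
    rw [LinearMap.mem_ker, Matrix.toLpLin_toLp] at this
    simpa using this
  · intro h v hv
    rw [LinearMap.mem_ker, Matrix.toLpLin_apply] at hv ⊢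
    rw [h _ (by simpa using hv)]
    rfl

/-- A zero diagonal entry of a positive matrix forces its whole column to vanish. Hence the relative
entropy to the diagonal part is finite. -/
theorem supp_le_supp_diagPart {ρ : Matrix ι ι ℂ} (hρ : ρ.PosSemidef) :
    supp ρ ≤ supp (diagPart ρ) := by
  rw [supp_le_supp_iff]
  intro v hv
  funext j
  refine Finset.sum_eq_zero fun i _ => ?_
  have h := congrFun hv i
  rw [diagPart, Matrix.mulVec_diagonal] at h
  change ρ j i * v i = 0
  rcases mul_eq_zero.mp h with h | h
  · rw [col_eq_zero_of_diag_eq_zero hρ h, zero_mul]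
  · rw [h, mul_zero]

theorem trace_mul_matrixLog_diagonal (ρ : Matrix ι ι ℂ) (d : ι → ℝ) :
    (ρ * matrixLog (Matrix.diagonal fun i => (d i : ℂ))).trace.re
      = ∑ i, (ρ i i).re * Real.logb 2 (d i) := by
  rw [matrixLog, cfc_diagonal]
  simp [Matrix.trace, Matrix.mul_diagonal, Complex.re_sum]

theorem relEntropy_diagPart {ρ V : Matrix ι ι ℂ} {w : ι → ℝ} (hρ : ρ.PosSemidef)
    (hV : Vᴴ * V = 1) (h : ρ = spectralMatrix V w)
    (hf : ∀ f : ℝ → ℝ, cfc f ρ = spectralMatrix V (f ∘ w)) :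
    relEntropy ρ (diagPart ρ)
      = ((negEntropy w - negEntropy (fun i => (ρ i i).re) : ℝ) : EReal) := by
  rw [relEntropy, if_pos (supp_le_supp_diagPart hρ), Matrix.mul_sub, trace_sub, Complex.sub_re]
  have hd : diagPart ρ = Matrix.diagonal fun i => ((ρ i i).re : ℂ) := by
    rw [diagPart]
    congr 1
    funext i
    exact (Complex.ext rfl (Complex.le_def.mp hρ.diag_nonneg).2.symm)
  rw [hd, trace_mul_matrixLog_diagonal, matrixLog, hf]
  conv_lhs => rw [h, spectralMatrix_mul hV, trace_spectralMatrix hV, ← h]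
  rfl

omit [DecidableEq ι] in
/-- The Gibbs inequality. -/
theorem sum_mul_logb_le_negEntropy {p q : ι → ℝ} (hp : ∀ i, 0 ≤ p i) (hq : ∀ i, 0 ≤ q i)
    (hpq : ∑ i, q i ≤ ∑ i, p i) (hac : ∀ i, q i = 0 → p i = 0) :
    ∑ i, p i * Real.logb 2 (q i) ≤ negEntropy p := by
  have hl : 0 < Real.log 2 := Real.log_pos one_lt_two
  -- This is log x ≤ x - 1 at x = q/p, multiplied by p.
  have key : ∀ i, p i * Real.log (q i) - p i * Real.log (p i) ≤ q i - p i := fun i => by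
    rcases (hp i).eq_or_lt with h | h
    · simp [← h, hq i]
    have hqi : 0 < q i := (hq i).lt_of_ne' fun h0 => h.ne' (hac i h0)
    have h1 := Real.log_le_sub_one_of_pos (div_pos hqi h)
    rw [Real.log_div hqi.ne' h.ne'] at h1
    have h2 := mul_le_mul_of_nonneg_left h1 h.le
    have h3 : p i * (q i / p i - 1) = q i - p i := by field_simp
    linarith
  have hs := Finset.sum_le_sum fun i (_ : i ∈ Finset.univ) => key i
  rw [Finset.sum_sub_distrib, Finset.sum_sub_distrib] at hs
  simp only [negEntropy, Real.logb, ← mul_div_assoc, ← Finset.sum_div]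
  exact (div_le_div_iff_of_pos_right hl).mpr (by linarith)

/-- The term tr(ρ log ρ) is independent of σ, and tr(ρ log σ) is a classical cross entropy, maximal
when σ has the diagonal of ρ. -/
theorem relEntropyCoherence_eq {ρ : Matrix ι ι ℂ} (hρ : ρ ∈ states ι) :
    relEntropyCoherence ρ = relEntropy ρ (diagPart ρ) := by
  refine le_antisymm (iInf₂_le _ (diagPart_mem_incoherent hρ)) (le_iInf₂ fun σ hσ => ?_)
  obtain ⟨V, w, hV, -, hw, hf⟩ := exists_spectralMatrix_eq hρ.1
  rw [relEntropy_diagPart hρ.1 hV hw hf, relEntropy]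
  split_ifs with hs
  · rw [EReal.coe_le_coe_iff, Matrix.mul_sub, trace_sub, Complex.sub_re]
    have e : (ρ * matrixLog ρ).trace.re = negEntropy w := by
      rw [matrixLog, hf]
      conv_lhs => rw [hw, spectralMatrix_mul hV, trace_spectralMatrix hV]
      rfl
    have hσd := eq_diagonal_re hσ.1.1 hσ.2
    rw [e, hσd, trace_mul_matrixLog_diagonal]
    refine sub_le_sub_left (sum_mul_logb_le_negEntropy (diag_re_nonneg hρ.1)
      (diag_re_nonneg hσ.1.1) (by rw [sum_diag_re hρ, sum_diag_re hσ.1]) fun i hi => ?_) _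
    -- A basis vector in the kernel of σ lies in the kernel of ρ: this is the absolute continuity
    -- that Gibbs needs.
    have h := supp_le_supp_iff.mp hs (Pi.single i 1) (by
      rw [hσd]
      funext j
      by_cases hj : j = i
      · subst hj; simp [Matrix.mulVec_diagonal, hi]
      · simp [Matrix.mulVec_diagonal, hj])
    have h2 := congrFun h i
    simp only [mulVec_single_one, col_apply, Pi.zero_apply] at h2
    simp [h2]
  · exact le_top

end RelEntropy

/-! ### Iid mixtures lie between the single product state and all incoherent states. -/

section Mixtures

variable {ι : Type*} [Fintype ι] [DecidableEq ι]

theorem iidMixtures_subset_incoherent (n : ℕ) :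
    iidMixtures ι n ⊆ incoherent (Fin n → ι) := by
  rintro τ ⟨μ, hμ, hinc, rfl⟩
  let g : (Fin n → ι) → (ι → ι → ℂ) → ℝ := fun x σ => ∏ i, (σ (x i) (x i)).re
  have hdiag : ∀ x y, ∫ σ, tensorPow n (Matrix.of σ) x y ∂μ
      = Matrix.diagonal (fun x => ((∫ σ, g x σ ∂μ : ℝ) : ℂ)) x y := fun x y => by
    by_cases h : x = y
    · subst h
      rw [Matrix.diagonal_apply_eq, ← integral_complex_ofReal]
      refine integral_congr_ae ?_
      filter_upwards [hinc] with σ hσ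
      have e : ∀ a, σ a a = ((σ a a).re : ℂ) := fun a =>
        Complex.ext rfl (Complex.le_def.mp (hσ.1.1.diag_nonneg (i := a))).2.symm
      simp only [tensorPow, Matrix.of_apply, g]
      push_cast
      exact Finset.prod_congr rfl fun i _ => e _
    · rw [Matrix.diagonal_apply_ne _ h]
      refine integral_eq_zero_of_ae ?_
      filter_upwards [hinc] with σ hσ
      obtain ⟨i, hi⟩ := Function.ne_iff.mp h
      exact Finset.prod_eq_zero (Finset.mem_univ i) (hσ.2 hi)
  have hτ : (Matrix.of fun x y => ∫ σ, tensorPow n (Matrix.of σ) x y ∂μ)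
      = Matrix.diagonal (fun x => ((∫ σ, g x σ ∂μ : ℝ) : ℂ)) := by
    ext x y
    exact hdiag x y
  rw [hτ]
  have hg0 : ∀ x, ∀ᵐ σ ∂μ, 0 ≤ g x σ := fun x => by
    filter_upwards [hinc] with σ hσ
    exact Finset.prod_nonneg fun i _ => diag_re_nonneg hσ.1.1 (x i)
  -- Integrability, from the bound 1 on a product of probabilities, lets the trace pass through the
  -- integral.
  have hgi : ∀ x, Integrable (g x) μ := fun x => by
    refine Integrable.of_bound (C := 1) ?_ ?_
    · have : Measurable (g x) := by fun_prop
      exact this.aestronglyMeasurable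
    · filter_upwards [hinc, hg0 x] with σ hσ h0
      rw [Real.norm_of_nonneg h0]
      refine Finset.prod_le_one (fun i _ => diag_re_nonneg hσ.1.1 (x i)) fun i _ => ?_
      have h1 := sum_diag_re hσ.1
      rw [← h1]
      exact Finset.single_le_sum (f := fun a => (Matrix.of σ a a).re)
        (fun a _ => diag_re_nonneg hσ.1.1 a) (Finset.mem_univ (x i))
  refine ⟨⟨.diagonal fun x => ?_, ?_⟩, Matrix.isDiag_diagonal _⟩
  · have := integral_nonneg_of_ae (hg0 x)
    simpa using this
  · rw [Matrix.trace_diagonal, ← Complex.ofReal_sum, ← integral_finsetSum _ fun x _ => hgi x]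
    have : ∫ σ, ∑ x, g x σ ∂μ = ∫ _, (1 : ℝ) ∂μ := by
      refine integral_congr_ae ?_
      filter_upwards [hinc] with σ hσ
      exact sum_prod_eq_one (p := fun a => (σ a a).re) (sum_diag_re hσ.1) n
    rw [this]
    simp

omit [DecidableEq ι] in
theorem tensorPow_mem_iidMixtures {σ : Matrix ι ι ℂ} (hσ : σ ∈ incoherent ι) (n : ℕ) :
    tensorPow n σ ∈ iidMixtures ι n := by
  refine ⟨Measure.dirac (Matrix.of.symm σ), inferInstance, ?_, ?_⟩
  · rw [ae_dirac_eq]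
    exact hσ
  · ext x y
    rw [Matrix.of_apply, integral_dirac]
    rfl

end Mixtures

/-! ### Bounds on the type 2 error. -/

section TypeTwoError

variable {κ : Type*} [Fintype κ] [DecidableEq κ]

/-- The trace is an average of the diagonal of `M` with weights from σ, so a bound on that diagonal
serves every incoherent alternative at once. -/
theorem trace_mul_re_le_of_diag_le {M σ : Matrix κ κ ℂ} (hσ : σ ∈ incoherent κ) {B : ℝ}
    (hM : ∀ x, (M x x).re ≤ B) : (M * σ).trace.re ≤ B := by
  have e : (M * σ).trace.re = ∑ x, (M x x).re * (σ x x).re := by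
    conv_lhs => rw [eq_diagonal_re hσ.1.1 hσ.2]
    simp [Matrix.trace, Matrix.mul_diagonal, Complex.re_sum]
  rw [e]
  calc ∑ x, (M x x).re * (σ x x).re ≤ ∑ x, B * (σ x x).re :=
        Finset.sum_le_sum fun x _ => mul_le_mul_of_nonneg_right (hM x) (diag_re_nonneg hσ.1.1 x)
    _ = B := by rw [← Finset.mul_sum, sum_diag_re hσ.1, mul_one]

theorem typeTwoError_le {ρ M : Matrix κ κ ℂ} {T : Set (Matrix κ κ ℂ)} (hT : T ⊆ incoherent κ)
    {ε B : ℝ} (hM : M ∈ tests ρ ε) (hB : ∀ x, (M x x).re ≤ B) :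
    typeTwoError ρ T ε ≤ ENNReal.ofReal B :=
  (iInf₂_le M hM).trans <| iSup₂_le fun _ hσ =>
    ENNReal.ofReal_le_ofReal (trace_mul_re_le_of_diag_le (hT hσ) hB)

theorem le_typeTwoError {ρ σ : Matrix κ κ ℂ} {T : Set (Matrix κ κ ℂ)} (hσ : σ ∈ T)
    {ε B : ℝ} (hB : ∀ M ∈ tests ρ ε, B ≤ (M * σ).trace.re) :
    ENNReal.ofReal B ≤ typeTwoError ρ T ε :=
  le_iInf₂ fun M hM => (ENNReal.ofReal_le_ofReal (hB M hM)).trans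
    (le_iSup₂ (f := fun σ (_ : σ ∈ T) => ENNReal.ofReal (M * σ).trace.re) σ hσ)

end TypeTwoError

/-! ### Asymptotics of the exponent. -/

section Exponent

variable {ι : Type*} [Fintype ι] [DecidableEq ι] {ρ : Matrix ι ι ℂ}
  {T : ∀ n : ℕ, Set (Matrix (Fin n → ι) (Fin n → ι) ℂ)}

/-- The exponent `-(1/n) log₂ x`. -/
noncomputable def rate (n : ℕ) (x : ℝ≥0∞) : EReal :=
  -(ENNReal.log x / ((Real.log 2 : ℝ) : EReal)) / (n : EReal)

theorem rate_antitone (n : ℕ) : Antitone (rate n) := fun x y h => by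
  refine EReal.div_le_div_right_of_nonneg (by positivity) (EReal.neg_le_neg_iff.mpr ?_)
  exact EReal.div_le_div_right_of_nonneg
    (EReal.coe_nonneg.mpr (Real.log_pos one_lt_two).le) (ENNReal.log_le_log h)

theorem rate_two_rpow {n : ℕ} (hn : 0 < n) (y : ℝ) :
    rate n (ENNReal.ofReal ((2 : ℝ) ^ (-(n * y)))) = y := by
  have hn' : (n : ℝ) ≠ 0 := by positivity
  have hl : Real.log 2 ≠ 0 := (Real.log_pos one_lt_two).ne'
  rw [rate, ENNReal.log_ofReal_of_pos (by positivity), Real.log_rpow two_pos]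
  rw [← EReal.coe_div, ← EReal.coe_neg, ← EReal.coe_natCast, ← EReal.coe_div]
  congr 1
  field_simp

/-- Achievability; each of the two typical sets costs one δ. -/
theorem eventually_le_exponentAt {V : Matrix ι ι ℂ} {w : ι → ℝ} (hρ : ρ ∈ states ι)
    (hV : Vᴴ * V = 1) (hw : ∀ a, 0 ≤ w a) (hw1 : ∑ a, w a = 1) (h : ρ = spectralMatrix V w)
    (hT : ∀ n, T n ⊆ incoherent (Fin n → ι)) {ε δ : ℝ} (hε : 0 < ε) (hδ : 0 < δ) :
    ∀ᶠ n : ℕ in atTop,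
      ((negEntropy w - negEntropy (fun i => (ρ i i).re) - 2 * δ : ℝ) : EReal)
        ≤ exponentAt ρ T n ε := by
  set d : ι → ℝ := fun i => (ρ i i).re with hd
  -- With t = ε the test satisfies (1+ε) tr(Mρ^{⊗n}) ≥ 1 - (2+ε⁻¹)η. This η turns the right side
  -- into 1 - ε² = (1+ε)(1-ε).
  have hη : 0 < ε ^ 2 / (2 + ε⁻¹) := by positivity
  filter_upwards [(tendsto_sum_compl_typicalSet hw hw1 hδ).eventually_le_const hη,
    (tendsto_sum_compl_typicalSet (diag_re_nonneg hρ.1) (sum_diag_re hρ) hδ).eventually_le_const hη,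
    eventually_gt_atTop 0] with n h1 h2 hn
  set η := ε ^ 2 / (2 + ε⁻¹) with hηd
  have hdn : ∀ x : Fin n → ι, (tensorPow n ρ x x).re = ∏ i, d (x i) := fun x => by
    have e : ∀ a, ρ a a = (d a : ℂ) := fun a =>
      Complex.ext rfl (Complex.le_def.mp (hρ.1.diag_nonneg (i := a))).2.symm
    simp only [tensorPow, Matrix.of_apply, e]
    exact_mod_cast rfl
  have hR : spectralMatrix (tensorPow n V) (fun x => ∏ i, w (x i)) = tensorPow n ρ := by
    rw [h, tensorPow_spectralMatrix]
  have hVn : (tensorPow n V)ᴴ * tensorPow n V = 1 := by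
    rw [← tensorPow_conjTranspose, ← tensorPow_mul, hV, tensorPow_one]
  obtain ⟨M, hM, hM', hMp, hMd⟩ := exists_test_with_small_diagonal (S := typicalSet d n δ)
    (T := typicalSet w n δ) (a := 2 ^ (n * (negEntropy w - δ)))
    (e := 2 ^ (n * (negEntropy d + δ))) (η := η) (t := ε) hVn
    (fun x => Finset.prod_nonneg fun i _ => hw _) (sum_prod_eq_one hw1 n) (by positivity)
    (by positivity) hε (fun x hx => by simp only [typicalSet, Finset.mem_filter] at hx; exact hx.2.1)
    (fun x hx => by
      simp only [typicalSet, Finset.mem_filter] at hx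
      rw [hR, hdn]; exact hx.2.2) h1 (by simpa only [hR, hdn] using h2)
  rw [hR] at hMp
  have htest : M ∈ tests (tensorPow n ρ) ε := by
    refine ⟨hM, hM', ?_⟩
    have h3 : η * (2 + ε⁻¹) = ε ^ 2 := by rw [hηd]; field_simp
    have h4 : (1 + ε) * (1 - ε) ≤ (1 + ε) * (M * tensorPow n ρ).trace.re := by linarith
    exact le_of_mul_le_mul_left h4 (by positivity)
  have hle := rate_antitone n (typeTwoError_le (hT n) htest hMd)
  rw [← Real.rpow_sub two_pos, show n * (negEntropy d + δ) - n * (negEntropy w - δ)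
    = -(n * (negEntropy w - negEntropy d - 2 * δ)) by ring, rate_two_rpow hn] at hle
  exact hle

/-- Strong converse; two δ come from the typical sets and the third absorbs a constant factor. -/
theorem eventually_exponentAt_le {V : Matrix ι ι ℂ} {w : ι → ℝ} (hρ : ρ ∈ states ι)
    (hV : Vᴴ * V = 1) (hw : ∀ a, 0 ≤ w a) (hw1 : ∑ a, w a = 1) (h : ρ = spectralMatrix V w)
    (hT : ∀ n, tensorPow n (diagPart ρ) ∈ T n) {ε δ : ℝ} (hε : ε < 1) (hδ : 0 < δ) :
    ∀ᶠ n : ℕ in atTop, exponentAt ρ T n ε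
      ≤ ((negEntropy w - negEntropy (fun i => (ρ i i).re) + 3 * δ : ℝ) : EReal) := by
  set d : ι → ℝ := fun i => (ρ i i).re with hd
  -- With p = 1 - ε this η gives (p - 3η)/2 = (1-ε)/4, which eventually exceeds 2^{-δn}.
  have hη : 0 < (1 - ε) / 6 := by linarith
  have hpow : Tendsto (fun n : ℕ => ((2 : ℝ) ^ (-δ)) ^ n) atTop (𝓝 0) :=
    tendsto_pow_atTop_nhds_zero_of_lt_one (by positivity)
      (Real.rpow_lt_one_of_one_lt_of_neg one_lt_two (by linarith))
  filter_upwards [(tendsto_sum_compl_typicalSet hw hw1 hδ).eventually_le_const hη,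
    (tendsto_sum_compl_typicalSet (diag_re_nonneg hρ.1) (sum_diag_re hρ) hδ).eventually_le_const hη,
    eventually_gt_atTop 0,
    hpow.eventually_le_const (by linarith : 0 < (1 - ε) / 4)] with n h1 h2 hn h3
  have hdn : ∀ x : Fin n → ι, (tensorPow n ρ x x).re = ∏ i, d (x i) := fun x => by
    have e : ∀ a, ρ a a = (d a : ℂ) := fun a =>
      Complex.ext rfl (Complex.le_def.mp (hρ.1.diag_nonneg (i := a))).2.symm
    simp only [tensorPow, Matrix.of_apply, e]
    exact_mod_cast rfl
  have hR : spectralMatrix (tensorPow n V) (fun x => ∏ i, w (x i)) = tensorPow n ρ := by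
    rw [h, tensorPow_spectralMatrix]
  have hVn : (tensorPow n V)ᴴ * tensorPow n V = 1 := by
    rw [← tensorPow_conjTranspose, ← tensorPow_mul, hV, tensorPow_one]
  have hle := rate_antitone n <| le_typeTwoError (ρ := tensorPow n ρ) (ε := ε)
    (B := 2 ^ (-(n * (negEntropy w - negEntropy d + 3 * δ)))) (hT n) fun M hM => by
    have hb := le_trace_mul_diagPart_of_test (S := typicalSet d n δ)
      (T := typicalSet w n δ) (b := 2 ^ (n * (negEntropy w + δ)))
      (c := 2 ^ (n * (negEntropy d - δ))) (η := (1 - ε) / 6) (p := 1 - ε) hVn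
      (fun x => Finset.prod_nonneg fun i _ => hw _) (by positivity) (by positivity)
      (fun x hx => by simp only [typicalSet, Finset.mem_filter] at hx; exact hx.2.2)
      (fun x hx => by
        simp only [typicalSet, Finset.mem_filter] at hx
        rw [hR, hdn]; exact hx.2.1) h1 (by simpa only [hR, hdn] using h2) hM.1 hM.2.1
      (by rw [hR]; exact hM.2.2)
    rw [hR] at hb
    rw [tensorPow_diagPart]
    refine le_trans ?_ hb
    rw [← Real.rpow_sub two_pos, show -(n * (negEntropy w - negEntropy d + 3 * δ))
      = (n * (negEntropy d - δ) - n * (negEntropy w + δ)) + (-δ) * n by ring,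
      Real.rpow_add two_pos, Real.rpow_mul two_pos.le, Real.rpow_natCast]
    refine mul_le_mul_of_nonneg_left ?_ (by positivity)
    linarith
  rw [rate_two_rpow hn] at hle
  exact hle

/-- Stein lemma with strong converse, for alternatives between the single state
`(diagPart ρ)^{⊗n}` and the set of all incoherent states. -/
theorem tendsto_exponentAt (hρ : ρ ∈ states ι) (hT : ∀ n, T n ⊆ incoherent (Fin n → ι))
    (hT' : ∀ n, tensorPow n (diagPart ρ) ∈ T n) {ε : ℝ} (hε : ε ∈ Set.Ioo (0 : ℝ) 1) :
    Tendsto (fun n : ℕ => exponentAt ρ T n ε) atTop (𝓝 (relEntropyCoherence ρ)) := by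
  obtain ⟨V, w, hV, hw, hρw, hf⟩ := exists_spectralMatrix_eq hρ.1
  have hw1 : ∑ a, w a = 1 := by
    rw [← trace_spectralMatrix hV, ← hρw, hρ.2, Complex.one_re]
  rw [relEntropyCoherence_eq hρ, relEntropy_diagPart hρ.1 hV hρw hf]
  set D := negEntropy w - negEntropy (fun i => (ρ i i).re)
  refine tendsto_order.mpr ⟨fun a ha => ?_, fun a ha => ?_⟩
  · obtain ⟨r, har, hr⟩ := EReal.lt_iff_exists_real_btwn.mp ha
    have hr' : r < D := EReal.coe_lt_coe_iff.mp hr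
    filter_upwards [eventually_le_exponentAt hρ hV hw hw1 hρw hT hε.1
      (by linarith : 0 < (D - r) / 2)] with n hn
    refine har.trans_le (le_trans (EReal.coe_le_coe_iff.mpr ?_) hn)
    linarith
  · obtain ⟨r, hr, har⟩ := EReal.lt_iff_exists_real_btwn.mp ha
    have hr' : D < r := EReal.coe_lt_coe_iff.mp hr
    filter_upwards [eventually_exponentAt_le hρ hV hw hw1 hρw hT' hε.2
      (by linarith : 0 < (r - D) / 3)] with n hn
    refine (le_trans hn (EReal.coe_le_coe_iff.mpr ?_)).trans_lt har
    linarith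

/-- By the strong converse ζ(ε) does not depend on ε in (0,1), so a constant function serves and the
limit ε → 0 is trivial. -/
theorem hasSteinExponent (hρ : ρ ∈ states ι) (hT : ∀ n, T n ⊆ incoherent (Fin n → ι))
    (hT' : ∀ n, tensorPow n (diagPart ρ) ∈ T n) :
    HasSteinExponent ρ T (relEntropyCoherence ρ) :=
  ⟨fun _ => relEntropyCoherence ρ, fun _ hε => tendsto_exponentAt hρ hT hT' hε,
    tendsto_const_nhds⟩

end Exponent

end Coherence

theorem mainTheorem4 {ι : Type*} [Fintype ι] [DecidableEq ι] (ρ : Matrix ι ι ℂ)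
    (hρ : ρ ∈ Coherence.states ι) :
    Coherence.HasSteinExponent ρ (fun n => Coherence.incoherent (Fin n → ι))
        (Coherence.relEntropyCoherence ρ) ∧
      Coherence.HasSteinExponent ρ (fun n => Coherence.iidMixtures ι n)
        (Coherence.relEntropyCoherence ρ) ∧
      Coherence.relEntropyCoherence ρ = Coherence.relEntropy ρ (Coherence.diagPart ρ) := by
  have hmem := Coherence.tensorPow_mem_iidMixtures (Coherence.diagPart_mem_incoherent hρ)
  exact ⟨Coherence.hasSteinExponent hρ (fun _ => subset_rfl) fun n =>
      Coherence.iidMixtures_subset_incoherent n (hmem n),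
    Coherence.hasSteinExponent hρ Coherence.iidMixtures_subset_incoherent hmem,
    Coherence.relEntropyCoherence_eq hρ⟩
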